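/- For a topological space $X$, the weight of $X$ is the least cardinality of a base; $X$ is zero-dimensional if its clopen sets form a base; and $X$ is countable dense homogeneous (CDH) if it is separable and for any two countable dense sets $D,E\subseteq X$ there is a homeomorphism $h\colon X\to X$ with $h[D]=E$. Let $\mathfrak b$ be the least cardinality of a family $F\subseteq\omega^\omega$ for which there is no $g\in\omega^\omega$ such that for every $f\in F$, $f(n)\le g(n)$ for all but finitely many $n$. A set $Y\subseteq 2^\omega$ is a $\lambda'$-set if every countable $C\subseteq 2^\omega$ is a relative $G_\delta$ subset of $Y\cup C$; it is saturated if $x\in Y$ whenever there are $y\in Y$ and $m,n\in\omega$ with $x(m+k)=y(n+k)$ for all $k\in\omega$. For $i\in\{0,1\}$ let $Q_i$ be the set of all $x\in2^\omega$ that are eventually equal to $i$, and let $Q=Q_0\cup Q_1$. For $Y\subseteq 2^\omega\setminus Q$ let $\mathbb A(Y)$ be the set $\big((2^\omega\setminus Q_0)\times\{0\}\big)\cup\big((Q_0\cup Y)\times\{1\}\big)$ with the order topology given by the lexicographic order, where $2^\omega$ is itself ordered lexicographically. **Corollary.** For every cardinal $\kappa<\mathfrak b$ there is a compact, zero-dimensional,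 CDH linearly ordered topological space of weight $\kappa$. Moreover, if $\kappa$ is infinite, there is a saturated $\lambda'$-set $Y\subseteq 2^\omega\setminus Q$ of cardinality $\kappa$ such that $\mathbb A(Y)$ is compact, zero-dimensional, CDH and of weight $\kappa$. -/

import Mathlib

open Set Filter Topology Cardinal

namespace CDHSpaces

/-! ### Topological notions -/

section
universe u
variable (X : Type u) [TopologicalSpace X]

/-- The weight of a topological space: the least cardinality of a base. -/
noncomputable def weight : Cardinal.{u} :=
  sInf {c | ∃ B : Set (Set X), TopologicalSpace.IsTopologicalBasis B ∧ #B = c}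

/-- A space is zero-dimensional if its clopen sets form a base. -/
def IsZeroDimensional : Prop :=
  TopologicalSpace.IsTopologicalBasis {U : Set X | IsClopen U}

/-- A space is countable dense homogeneous (CDH) if it is separable and any countable dense set
can be carried onto any other one by a self-homeomorphism. -/
def IsCDH : Prop :=
  TopologicalSpace.SeparableSpace X ∧
    ∀ D E : Set X, D.Countable → Dense D → E.Countable → Dense E →
      ∃ h : X ≃ₜ X, h '' D = E

end

/-! ### The bounding number -/

/-- A family of functions from `ℕ` to `ℕ` is bounded if a single function eventually dominates
each of its members. -/
def IsEventuallyBounded (F : Set (ℕ → ℕ)) : Prop :=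
  ∃ g : ℕ → ℕ, ∀ f ∈ F, ∀ᶠ n in atTop, f n ≤ g n

/-- The bounding number: the least cardinality of an unbounded family. -/
noncomputable def boundingNumber : Cardinal.{0} :=
  sInf {c | ∃ F : Set (ℕ → ℕ), ¬ IsEventuallyBounded F ∧ #F = c}

/-! ### Subsets of the Cantor set `ℕ → Bool` -/

/-- A `λ'`-set: each countable `C ⊆ 2^ω` is a relative `G_δ` subset of `X ∪ C`. -/
def IsLambdaPrimeSet (X : Set (ℕ → Bool)) : Prop :=
  ∀ C : Set (ℕ → Bool), C.Countable → IsGδ ((↑) ⁻¹' C : Set (X ∪ C : Set (ℕ → Bool)))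

/-- Tail equivalence. -/
def TailEquiv (x y : ℕ → Bool) : Prop :=
  ∃ m n : ℕ, ∀ k : ℕ, x (m + k) = y (n + k)

/-- The saturation of a set with respect to tail equivalence. -/
def saturation (X : Set (ℕ → Bool)) : Set (ℕ → Bool) :=
  {y | ∃ x ∈ X, TailEquiv y x}

/-- A set is saturated if it equals its saturation. -/
def IsSaturated (X : Set (ℕ → Bool)) : Prop :=
  X = saturation X

/-- The sequences that are eventually equal to `i` (with `0 = false`, `1 = true`). -/
def eventuallyEq (i : Bool) : Set (ℕ → Bool) :=
  {x | ∃ n : ℕ, ∀ m : ℕ, n ≤ m → x m = i}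

/-! ### The double arrow space over a set -/

/-- The underlying set `((2^ω ∖ Q₀) × {0}) ∪ ((Q₀ ∪ X) × {1})`, where `Q₀` is the set of
sequences that are eventually `0`, inside `2^ω × {0, 1}` with the lexicographic order, where `2^ω`
itself is ordered lexicographically. -/
def doubleArrowSet (X : Set (ℕ → Bool)) : Set (Lex (ℕ → Bool) ×ₗ Bool) :=
  {p | ((ofLex p).2 = false ∧ ofLex (ofLex p).1 ∉ eventuallyEq false) ∨
       ((ofLex p).2 = true ∧ ofLex (ofLex p).1 ∈ eventuallyEq false ∪ X)}

/-- The double arrow space over `X`. -/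
def DoubleArrow (X : Set (ℕ → Bool)) : Type :=
  doubleArrowSet X

noncomputable instance (X : Set (ℕ → Bool)) : LinearOrder (DoubleArrow X) :=
  inferInstanceAs (LinearOrder (doubleArrowSet X))

/-- The topology of the double arrow space is its own order topology. -/
noncomputable instance (X : Set (ℕ → Bool)) : TopologicalSpace (DoubleArrow X) :=
  Preorder.topology (DoubleArrow X)

instance (X : Set (ℕ → Bool)) : OrderTopology (DoubleArrow X) :=
  ⟨rfl⟩

end CDHSpaces

/-! For infinite κ, let `Y` be the saturation of κ points outside `Q`. It has size κ, and κ < 𝔟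
makes it a λ'-set. The digits of a point, together with its side of the gap at each `y ∈ Y`, embed
the double arrow space as a closed subset of `2^(ℕ ⊕ Y)` (`range_coord`). This gives compactness,
zero-dimensionality and weight at most κ; the κ gaps force weight at least κ.

For homogeneity, let `C` be the countable saturation of the first coordinates of two countable dense
sets. A back-and-forth produces homeomorphisms whose coordinates stabilize, hence converge
(`exists_homeomorph_image_eq`). It needs two things. Points over `C` can be moved onto each other
inside any open set (`locallyMovable`): small clopen neighbourhoods split into infinitely many
branches, which are matched by exchanging prefixes, and saturation keeps the result in the space.
And the coordinates, perhaps uncountably many, are exhausted in ω stages, each simultaneously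
locally constant at points over `C`. The λ' property supplies the stages: if `C` is the trace of `⋂
V k` on `Y ∪ C`, the gaps outside `V k` lie in a closed set missing `C`. -/

namespace CDHSpaces

/-! ### Back-and-forth along a countable exhaustion of the coordinates. -/

section BackAndForth

variable {X ι : Type*} [TopologicalSpace X] {χ : ι → X → Bool}

/-- Closedness of the image in `2^ι` lets coordinatewise limits of points be realized by points. -/
theorem isClosedEmbedding_of_separating [CompactSpace X] (hχ : ∀ i, Continuous (χ i))
    (hsep : ∀ x y, (∀ i, χ i x = χ i y) → x = y) :
    IsClosedEmbedding (fun x i => χ i x) :=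
  (continuous_pi hχ).isClosedEmbedding fun x y h => hsep x y fun i => congrFun h i

/-- A sequence of continuous maps whose coordinates stabilize has a continuous limit. -/
theorem exists_continuous_limit [CompactSpace X] (hχ : ∀ i, Continuous (χ i))
    (hsep : ∀ x y, (∀ i, χ i x = χ i y) → x = y)
    {I : ℕ → Set ι} (hI : Monotone I) (hex : ∀ i, ∃ n, i ∈ I n)
    (f : ℕ → X → X) (hf : ∀ n, Continuous (f n))
    (hc : ∀ n, ∀ i ∈ I n, ∀ x, χ i (f (n + 1) x) = χ i (f n x)) :
    ∃ g : X → X, Continuous g ∧ (∀ x, Tendsto (fun n => f n x) atTop (𝓝 (g x))) ∧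
      ∀ m, ∀ i ∈ I m, ∀ x, ∀ n ≥ m, χ i (f n x) = χ i (g x) := by
  have he := isClosedEmbedding_of_separating hχ hsep
  have hstab : ∀ m, ∀ i ∈ I m, ∀ x, ∀ n ≥ m, χ i (f n x) = χ i (f m x) := by
    intro m i hi x n hn
    induction n, hn using Nat.le_induction with
    | base => rfl
    | succ n hn ih => rw [hc n i (hI hn hi) x, ih]
  choose N hN using hex
  have hlim : ∀ x, Tendsto (fun n i => χ i (f n x)) atTop (𝓝 fun i => χ i (f (N i) x)) := by
    intro x
    rw [tendsto_pi_nhds]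
    intro i
    apply tendsto_const_nhds.congr'
    filter_upwards [eventually_ge_atTop (N i)] with n hn
    exact (hstab _ i (hN i) x n hn).symm
  have hmem : ∀ x, ∃ z, (fun i => χ i z) = fun i => χ i (f (N i) x) := fun x =>
    he.isClosed_range.mem_of_tendsto (hlim x) (Eventually.of_forall fun n => ⟨f n x, rfl⟩)
  choose g hg using hmem
  have hg' : ∀ i x, χ i (g x) = χ i (f (N i) x) := fun i x => congrFun (hg x) i
  refine ⟨g, ?_, ?_, ?_⟩
  · rw [he.isInducing.continuous_iff]
    refine continuous_pi fun i => ?_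
    have : (fun x => χ i (g x)) = χ i ∘ f (N i) := funext fun x => hg' i x
    exact this ▸ (hχ i).comp (hf _)
  · intro x
    rw [he.isInducing.tendsto_nhds_iff]
    have := hlim x
    rw [← hg x] at this
    exact this
  · intro m i hi x n hn
    rw [hg', hstab m i hi x n hn, ← hstab m i hi x _ (le_max_left m (N i)),
      hstab (N i) i (hN i) x _ (le_max_right m (N i))]

/-- A sequence of homeomorphisms whose coordinates stabilize in both directions converges to a
homeomorphism. -/
theorem exists_homeomorph_limit [CompactSpace X] (hχ : ∀ i, Continuous (χ i))
    (hsep : ∀ x y, (∀ i, χ i x = χ i y) → x = y)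
    {I : ℕ → Set ι} (hI : Monotone I) (hex : ∀ i, ∃ n, i ∈ I n)
    (h : ℕ → X ≃ₜ X) (hc : ∀ n, ∀ i ∈ I n, ∀ x, χ i (h (n + 1) x) = χ i (h n x) ∧
      χ i ((h (n + 1)).symm x) = χ i ((h n).symm x)) :
    ∃ g : X ≃ₜ X, ∀ x, Tendsto (fun n => h n x) atTop (𝓝 (g x)) := by
  obtain ⟨f, hf, hft, hfs⟩ := exists_continuous_limit hχ hsep hI hex (fun n => h n)
    (fun n => (h n).continuous) fun n i hi x => (hc n i hi x).1
  obtain ⟨g, hg, hgt, hgs⟩ := exists_continuous_limit hχ hsep hI hex (fun n => (h n).symm)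
    (fun n => (h n).symm.continuous) fun n i hi x => (hc n i hi x).2
  have hgf : ∀ x, g (f x) = x := by
    intro x
    refine hsep _ _ fun i => ?_
    obtain ⟨m, hm⟩ := hex i
    -- From stage `m` on, coordinate `i` of the inverses no longer changes, so `(h m).symm` may be
    -- traded for `(h n).symm`, which cancels `h n`.
    rw [← hgs m i hm (f x) m le_rfl]
    have h1 : Tendsto (fun n => χ i ((h m).symm (h n x))) atTop (𝓝 (χ i ((h m).symm (f x)))) :=
      (((hχ i).comp (h m).symm.continuous).tendsto _).comp (hft x)
    refine tendsto_nhds_unique h1 (tendsto_const_nhds.congr' ?_)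
    filter_upwards [eventually_ge_atTop m] with n hn
    rw [hgs m i hm _ m le_rfl, ← hgs m i hm _ n hn, (h n).symm_apply_apply]
  have hfg : ∀ x, f (g x) = x := by
    intro x
    refine hsep _ _ fun i => ?_
    obtain ⟨m, hm⟩ := hex i
    rw [← hfs m i hm (g x) m le_rfl]
    have h1 : Tendsto (fun n => χ i (h m ((h n).symm x))) atTop (𝓝 (χ i (h m (g x)))) :=
      (((hχ i).comp (h m).continuous).tendsto _).comp (hgt x)
    refine tendsto_nhds_unique h1 (tendsto_const_nhds.congr' ?_)
    filter_upwards [eventually_ge_atTop m] with n hn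
    rw [hfs m i hm _ m le_rfl, ← hfs m i hm _ n hn, (h n).apply_symm_apply]
  exact ⟨⟨⟨f, g, hgf, hfg⟩, hf, hg⟩, hft⟩

/-- Points of `P` can be moved inside open sets by homeomorphisms that preserve `P`. -/
def LocallyMovable (P : Set X) : Prop :=
  ∀ U : Set X, IsOpen U → ∀ d ∈ U ∩ P, ∀ e ∈ U ∩ P, ∃ u : X ≃ₜ X,
    u d = e ∧ (∀ p ∉ U, u p = p) ∧ ∀ p, u p ∈ P ↔ p ∈ P

/-- One forth step: precompose `h` with a homeomorphism supported near `d` that moves `d` to a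
preimage of a point of `E`. The coordinates in `J` do not notice, being constant near `d` and near
`h d`. -/
theorem exists_homeomorph_extend [T2Space X] {P D E : Set X} (hP : LocallyMovable P)
    (hD : D ⊆ P) (hE : E ⊆ P) (hEd : Dense E) {J : Set ι}
    (hJ : ∀ p ∈ P, ∃ O, IsOpen O ∧ p ∈ O ∧ ∀ i ∈ J, ∀ q ∈ O, χ i q = χ i p)
    (h : X ≃ₜ X) (hh : ∀ p, h p ∈ P ↔ p ∈ P) {S : Set X} (hS : S.Finite)
    (hSE : ∀ s ∈ S, h s ∈ E) {d : X} (hd : d ∈ D) :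
    ∃ h' : X ≃ₜ X, (∀ p, h' p ∈ P ↔ p ∈ P) ∧ h' d ∈ E ∧ (∀ s ∈ S, h' s = h s) ∧
      ∀ i ∈ J, ∀ x, χ i (h' x) = χ i (h x) ∧ χ i (h'.symm x) = χ i (h.symm x) := by
  by_cases hdS : d ∈ S
  · exact ⟨h, hh, hSE d hdS, fun _ _ => rfl, fun _ _ _ => ⟨rfl, rfl⟩⟩
  obtain ⟨O, hO, hdO, hOJ⟩ := hJ d (hD hd)
  obtain ⟨O', hO', hdO', hOJ'⟩ := hJ (h d) ((hh d).2 (hD hd))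
  -- `O` controls the inverse, `O'` controls the map, and removing `S` protects the values already
  -- fixed.
  set U : Set X := (O ∩ h ⁻¹' O') ∩ Sᶜ with hU
  have hUo : IsOpen U := (hO.inter (hO'.preimage h.continuous)).inter hS.isClosed.isOpen_compl
  have hdU : d ∈ U := ⟨⟨hdO, hdO'⟩, hdS⟩
  obtain ⟨e, heU, heE⟩ := hEd.inter_open_nonempty (h '' U) (h.isOpenMap U hUo)
    ⟨h d, mem_image_of_mem h hdU⟩
  obtain ⟨c, hcU, rfl⟩ := heU
  obtain ⟨u, hud, hu, huP⟩ := hP U hUo d ⟨hdU, hD hd⟩ c ⟨hcU, (hh c).1 (hE heE)⟩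
  have huU : ∀ p ∈ U, u p ∈ U := by
    intro p hp
    by_contra hcon
    have := u.injective (hu _ hcon)
    rw [this] at hcon
    exact hcon hp
  have huU' : ∀ p ∈ U, u.symm p ∈ U := by
    intro p hp
    by_contra hcon
    have := hu _ hcon
    rw [u.apply_symm_apply] at this
    exact hcon (this ▸ hp)
  refine ⟨u.trans h, fun p => ?_, ?_, fun s hs => ?_, fun i hi x => ⟨?_, ?_⟩⟩
  · simp [hh, huP]
  · simpa [hud] using heE
  · have : u s = s := hu s fun hsU => hsU.2 hs
    simp [this]
  · by_cases hx : x ∈ U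
    · simp only [Homeomorph.trans_apply]
      rw [hOJ' i hi _ (huU x hx).1.2, hOJ' i hi _ hx.1.2]
    · simp [hu x hx]
  · simp only [Homeomorph.symm_trans_apply]
    by_cases hx : h.symm x ∈ U
    · rw [hOJ i hi _ (huU' _ hx).1.1, hOJ i hi _ hx.1.1]
    · have := hu _ hx
      conv_lhs => rw [← this]
      simp

theorem exists_homeomorph_image_eq [CompactSpace X] [T2Space X] (hχ : ∀ i, Continuous (χ i))
    (hsep : ∀ x y, (∀ i, χ i x = χ i y) → x = y)
    {I : ℕ → Set ι} (hI : Monotone I) (hex : ∀ i, ∃ n, i ∈ I n)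
    {P D E : Set X} (hP : LocallyMovable P)
    (hJ : ∀ n, ∀ p ∈ P, ∃ O, IsOpen O ∧ p ∈ O ∧ ∀ i ∈ I n, ∀ q ∈ O, χ i q = χ i p)
    (hD : D ⊆ P) (hE : E ⊆ P) (hDc : D.Countable) (hEc : E.Countable)
    (hDd : Dense D) (hEd : Dense E) :
    ∃ h : X ≃ₜ X, h '' D = E := by
  rcases isEmpty_or_nonempty X with hX | hX
  · exact ⟨Homeomorph.refl X, Set.ext fun x => isEmptyElim x⟩
  obtain ⟨d, rfl⟩ := hDc.exists_eq_range hDd.nonempty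
  obtain ⟨e, rfl⟩ := hEc.exists_eq_range hEd.nonempty
  let State := {s : (X ≃ₜ X) × Set X // s.2.Finite ∧ s.2 ⊆ range d ∧ (∀ p, s.1 p ∈ P ↔ p ∈ P) ∧
    ∀ x ∈ s.2, s.1 x ∈ range e}
  have step : ∀ (n : ℕ) (s : State), ∃ t : State, d n ∈ t.1.2 ∧ e n ∈ t.1.1 '' t.1.2 ∧
      s.1.2 ⊆ t.1.2 ∧ (∀ x ∈ s.1.2, t.1.1 x = s.1.1 x) ∧
      ∀ i ∈ I n, ∀ x, χ i (t.1.1 x) = χ i (s.1.1 x) ∧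
        χ i (t.1.1.symm x) = χ i (s.1.1.symm x) := by
    rintro n ⟨⟨h, S⟩, hSf, hSD, hh, hSE⟩
    obtain ⟨h₁, hh₁, hd₁, hS₁, hc₁⟩ := exists_homeomorph_extend hP hD hE hEd (hJ n) h hh hSf hSE
      (mem_range_self n)
    have hTf : (h₁ '' insert (d n) S).Finite := (hSf.insert _).image _
    -- The back step is the forth step for the inverse, with the roles of `D` and `E` exchanged.
    obtain ⟨h₂, hh₂, he₂, hS₂, hc₂⟩ := exists_homeomorph_extend hP hE hD hDd (hJ n) h₁.symm
      (fun p => by simpa using (hh₁ (h₁.symm p)).symm) hTf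
      (by
        rintro _ ⟨x, rfl | hx, rfl⟩
        · simp
        · simpa using hSD hx) (mem_range_self n)
    have hfix : ∀ x ∈ insert (d n) S, h₂.symm x = h₁ x := by
      intro x hx
      have := hS₂ _ (mem_image_of_mem h₁ hx)
      rw [h₁.symm_apply_apply] at this
      conv_lhs => rw [← this]
      simp
    refine ⟨⟨⟨h₂.symm, insert (h₂ (e n)) (insert (d n) S)⟩, (hSf.insert _).insert _, ?_, ?_, ?_⟩,
      ?_, ?_, ?_, ?_, ?_⟩
    · rintro x (rfl | rfl | hx)
      · exact he₂
      · exact mem_range_self n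
      · exact hSD hx
    · intro p
      simpa using (hh₂ (h₂.symm p)).symm
    · rintro x (rfl | hx)
      · simp
      · change h₂.symm x ∈ _
        rw [hfix x hx]
        rcases hx with rfl | hx
        · exact hd₁
        · rw [hS₁ x hx]; exact hSE x hx
    · exact mem_insert_of_mem _ (mem_insert _ _)
    · exact ⟨h₂ (e n), mem_insert _ _, by simp⟩
    · exact fun x hx => mem_insert_of_mem _ (mem_insert_of_mem _ hx)
    · intro x hx
      change h₂.symm x = h x
      rw [hfix x (mem_insert_of_mem _ hx), hS₁ x hx]
    · intro i hi x
      have a := hc₁ i hi x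
      have b := hc₂ i hi x
      exact ⟨b.2.trans a.1, b.1.trans a.2⟩
  choose next hn₁ hn₂ hn₃ hn₄ hn₅ using step
  let s₀ : State := ⟨⟨Homeomorph.refl X, ∅⟩, finite_empty, empty_subset _, fun p => Iff.rfl,
    fun x hx => hx.elim⟩
  let s : ℕ → State := fun n => Nat.rec s₀ (fun n t => next n t) n
  have hs : ∀ n, s (n + 1) = next n (s n) := fun n => rfl
  obtain ⟨h, hh⟩ := exists_homeomorph_limit hχ hsep hI hex (fun n => (s n).1.1)
    (fun n i hi x => by simpa only [hs] using hn₅ n (s n) i hi x)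
  have hstab : ∀ m, ∀ x ∈ (s m).1.2, h x = (s m).1.1 x := by
    intro m x hx
    have key : ∀ n ≥ m, x ∈ (s n).1.2 ∧ (s n).1.1 x = (s m).1.1 x := by
      intro n hn
      induction n, hn using Nat.le_induction with
      | base => exact ⟨hx, rfl⟩
      | succ n hn ih =>
        rw [hs]
        exact ⟨hn₃ n _ ih.1, (hn₄ n _ x ih.1).trans ih.2⟩
    refine tendsto_nhds_unique (hh x) (tendsto_const_nhds.congr' ?_)
    filter_upwards [eventually_ge_atTop m] with n hn
    exact (key n hn).2.symm
  refine ⟨h, Subset.antisymm ?_ ?_⟩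
  · rintro _ ⟨_, ⟨n, rfl⟩, rfl⟩
    have hm : d n ∈ (s (n + 1)).1.2 := by rw [hs]; exact hn₁ n _
    rw [hstab (n + 1) _ hm]
    exact (s (n + 1)).2.2.2.2 _ hm
  · rintro _ ⟨n, rfl⟩
    obtain ⟨x, hx, hxe⟩ : e n ∈ (s (n + 1)).1.1 '' (s (n + 1)).1.2 := by rw [hs]; exact hn₂ n _
    refine ⟨x, (s (n + 1)).2.2.1 hx, ?_⟩
    rw [hstab (n + 1) _ hx, hxe]

end BackAndForth

theorem isClopen_setOf_eq {T : Type*} [TopologicalSpace T] {f : T → Bool} (hf : Continuous f)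
    (b : Bool) : IsClopen {t | f t = b} := by
  have h : IsClopen (f ⁻¹' {b}) := (isClopen_discrete {b}).preimage hf
  exact h

/-! ### Tail equivalence -/

theorem TailEquiv.refl (x : ℕ → Bool) : TailEquiv x x := ⟨0, 0, fun _ => rfl⟩

theorem TailEquiv.symm {x y : ℕ → Bool} : TailEquiv x y → TailEquiv y x
  | ⟨m, n, h⟩ => ⟨n, m, fun k => (h k).symm⟩

theorem TailEquiv.trans {x y z : ℕ → Bool} : TailEquiv x y → TailEquiv y z → TailEquiv x z
  | ⟨m, n, h⟩, ⟨m', n', h'⟩ => ⟨m + m', n' + n, fun k => by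
      rw [add_assoc, h, add_assoc, ← h']
      congr 1
      omega⟩

theorem subset_saturation (X : Set (ℕ → Bool)) : X ⊆ saturation X :=
  fun x hx => ⟨x, hx, .refl x⟩

theorem isSaturated_saturation (X : Set (ℕ → Bool)) : IsSaturated (saturation X) :=
  (subset_saturation _).antisymm fun _ ⟨_, ⟨z, hz, hyz⟩, hxy⟩ => ⟨z, hz, hxy.trans hyz⟩

theorem IsSaturated.mem_of_tailEquiv {Y : Set (ℕ → Bool)} (hY : IsSaturated Y) {x y : ℕ → Bool}
    (h : TailEquiv x y) (hy : y ∈ Y) : x ∈ Y := by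
  rw [hY]
  exact ⟨y, hy, h⟩

theorem IsSaturated.mem_iff {Y : Set (ℕ → Bool)} (hY : IsSaturated Y) {x y : ℕ → Bool}
    (h : TailEquiv x y) : x ∈ Y ↔ y ∈ Y :=
  ⟨hY.mem_of_tailEquiv h.symm, hY.mem_of_tailEquiv h⟩

theorem isSaturated_eventuallyEq (i : Bool) : IsSaturated (eventuallyEq i) := by
  refine (subset_saturation _).antisymm ?_
  rintro x ⟨y, ⟨N, hN⟩, m, n, h⟩
  refine ⟨m + N, fun j hj => ?_⟩
  obtain ⟨k, rfl⟩ := Nat.exists_eq_add_of_le ((Nat.le_add_right m N).trans hj)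
  rw [h, hN _ (by omega)]

/-- Such a sequence is a finite word followed by a tail of `x`. -/
theorem countable_tailEquiv (x : ℕ → Bool) : {y | TailEquiv y x}.Countable := by
  refine (countable_range fun p : ℕ × List Bool =>
    fun i => if i < p.2.length then p.2.getD i false else x (p.1 + (i - p.2.length))).mono ?_
  rintro y ⟨m, n, h⟩
  refine ⟨⟨n, List.ofFn fun i : Fin m => y i⟩, funext fun i => ?_⟩
  simp only [List.length_ofFn]
  split_ifs with hi
  · simp [List.getD, hi]
  · rw [← h]
    congr 1
    omega

theorem countable_saturation {C : Set (ℕ → Bool)} (hC : C.Countable) :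
    (saturation C).Countable := by
  refine (hC.biUnion fun x _ => countable_tailEquiv x).mono ?_
  rintro y ⟨x, hx, h⟩
  exact mem_biUnion hx h

theorem countable_eventuallyEq (i : Bool) : (eventuallyEq i).Countable := by
  refine (countable_saturation (countable_singleton fun _ => i)).mono ?_
  rintro x ⟨n, hn⟩
  exact ⟨_, rfl, n, 0, fun k => hn _ (by omega)⟩

/-! ### Changing initial segments -/

/-- Replace the first `n` entries of `z` by the first `k` entries of `a`. -/
def graft (a : ℕ → Bool) (k n : ℕ) (z : ℕ → Bool) : ℕ → Bool :=
  fun i => if i < k then a i else z (i - k + n)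

theorem graft_apply_of_lt (a : ℕ → Bool) {k i : ℕ} (n : ℕ) (z : ℕ → Bool) (h : i < k) :
    graft a k n z i = a i := if_pos h

theorem graft_apply_add (a : ℕ → Bool) (k i n : ℕ) (z : ℕ → Bool) :
    graft a k n z (k + i) = z (n + i) := by
  simp [graft, add_comm]

theorem tailEquiv_graft (a : ℕ → Bool) (k n : ℕ) (z : ℕ → Bool) : TailEquiv (graft a k n z) z :=
  ⟨k, n, fun i => graft_apply_add a k i n z⟩

theorem graft_graft (a b : ℕ → Bool) (k n : ℕ) (z : ℕ → Bool) (hz : ∀ i < n, z i = b i) :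
    graft b n k (graft a k n z) = z := by
  funext i
  by_cases hi : i < n
  · rw [graft_apply_of_lt _ _ _ hi, hz i hi]
  · obtain ⟨j, rfl⟩ := Nat.exists_eq_add_of_le (not_lt.1 hi)
    rw [graft_apply_add, graft_apply_add]

theorem continuous_graft (a : ℕ → Bool) (k n : ℕ) : Continuous (graft a k n) := by
  refine continuous_pi fun i => ?_
  by_cases hi : i < k
  · simp only [graft, if_pos hi]
    exact continuous_const
  · simp only [graft, if_neg hi]
    exact continuous_apply _

theorem lex_lt_iff {x y : ℕ → Bool} :
    toLex x < toLex y ↔ ∃ i, (∀ j < i, x j = y j) ∧ x i = false ∧ y i = true := by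
  refine exists_congr fun i => and_congr Iff.rfl ?_
  change x i < y i ↔ _
  cases x i <;> cases y i <;> decide

theorem graft_lt_graft {a b : ℕ → Bool} {k n : ℕ} {y z : ℕ → Bool} (hy : ∀ i < n, y i = b i)
    (hz : ∀ i < n, z i = b i) (h : toLex y < toLex z) :
    toLex (graft a k n y) < toLex (graft a k n z) := by
  obtain ⟨i, hi, h0, h1⟩ := lex_lt_iff.1 h
  have hni : n ≤ i := by
    by_contra! hlt
    rw [hy i hlt, ← hz i hlt, h1] at h0
    exact absurd h0 (by decide)
  obtain ⟨j, rfl⟩ := Nat.exists_eq_add_of_le hni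
  refine lex_lt_iff.2 ⟨k + j, fun l hl => ?_, ?_, ?_⟩
  · by_cases hlk : l < k
    · rw [graft_apply_of_lt _ _ _ hlk, graft_apply_of_lt _ _ _ hlk]
    · obtain ⟨m, rfl⟩ := Nat.exists_eq_add_of_le (not_lt.1 hlk)
      rw [graft_apply_add, graft_apply_add, hi _ (by omega)]
  · rw [graft_apply_add, h0]
  · rw [graft_apply_add, h1]

/-- The comparison with `y` is settled before position `n`. Hence a gap outside a cylinder has the
whole cylinder on one side. -/
theorem lex_lt_iff_of_agree {x y z : ℕ → Bool} {n : ℕ} (h : ∀ i < n, z i = x i)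
    (hy : ∃ i < n, y i ≠ x i) : toLex y < toLex z ↔ toLex y < toLex x := by
  obtain ⟨i, hi, hne⟩ := hy
  simp only [lex_lt_iff]
  have key : ∀ x z : ℕ → Bool, (∀ i < n, z i = x i) → y i ≠ x i →
      (∃ i, (∀ j < i, y j = z j) ∧ y i = false ∧ z i = true) →
      ∃ i, (∀ j < i, y j = x j) ∧ y i = false ∧ x i = true := by
    rintro x z h hne ⟨k, hk, h0, h1⟩
    have hki : k ≤ i := by
      by_contra! hlt
      exact hne (by rw [hk i hlt, h i hi])
    exact ⟨k, fun j hj => by rw [hk j hj, h j (by omega)], h0, by rw [← h k (by omega), h1]⟩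
  exact ⟨key x z h hne, key z x (fun i hi => (h i hi).symm) (by rwa [h i hi])⟩

theorem isOpen_setOf_lex_lt (y : ℕ → Bool) :
    IsOpen {x : ℕ → Bool | toLex y < toLex x} ∧ IsOpen {x : ℕ → Bool | toLex x < toLex y} := by
  have hc : ∀ (n : ℕ) (x : ℕ → Bool), IsOpen {z : ℕ → Bool | ∀ j < n + 1, z j = x j} := by
    intro n x
    have : {z : ℕ → Bool | ∀ j < n + 1, z j = x j} = ⋂ j ∈ Iio (n + 1), {z | z j = x j} := by
      ext; simp
    rw [this]
    exact (finite_Iio _).isOpen_biInter fun j _ => (isClopen_setOf_eq (continuous_apply j) _).isOpen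
  constructor
  · refine isOpen_iff_forall_mem_open.2 fun x hx => ?_
    obtain ⟨i, hi, h0, h1⟩ := lex_lt_iff.1 hx
    exact ⟨_, fun z hz => lex_lt_iff.2 ⟨i, fun j hj => by rw [hi j hj, hz j (by omega)], h0,
      by rw [hz i (by omega), h1]⟩, hc i x, fun _ _ => rfl⟩
  · refine isOpen_iff_forall_mem_open.2 fun x hx => ?_
    obtain ⟨i, hi, h0, h1⟩ := lex_lt_iff.1 hx
    exact ⟨_, fun z hz => lex_lt_iff.2 ⟨i, fun j hj => by rw [hz j (by omega), hi j hj],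
      by rw [hz i (by omega), h0], h1⟩, hc i x, fun _ _ => rfl⟩

/-! ### Coordinates on the double arrow space -/

namespace DoubleArrow

variable {Y : Set (ℕ → Bool)}

/-- The first coordinate of a point. -/
def proj (p : DoubleArrow Y) : ℕ → Bool := ofLex (ofLex p.1).1

/-- The second coordinate of a point. -/
def level (p : DoubleArrow Y) : Bool := (ofLex p.1).2

theorem level_spec (p : DoubleArrow Y) :
    (p.level = false ∧ p.proj ∉ eventuallyEq false) ∨
      (p.level = true ∧ p.proj ∈ eventuallyEq false ∪ Y) := p.2

/-- The point with the given coordinates. -/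
def mk (x : ℕ → Bool) (b : Bool) (h : (b = false ∧ x ∉ eventuallyEq false) ∨
    (b = true ∧ x ∈ eventuallyEq false ∪ Y)) : DoubleArrow Y :=
  ⟨toLex (toLex x, b), h⟩

@[simp] theorem proj_mk {x : ℕ → Bool} {b : Bool} (h) : (mk x b h : DoubleArrow Y).proj = x := rfl

@[simp] theorem level_mk {x : ℕ → Bool} {b : Bool} (h) : (mk x b h : DoubleArrow Y).level = b := rfl

theorem ext {p q : DoubleArrow Y} (h : p.proj = q.proj) (h' : p.level = q.level) : p = q :=
  Subtype.ext (Prod.ext h h')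

/-- Only sequences in `Y` are doubled. -/
theorem level_eq_of_notMem {p q : DoubleArrow Y} (h : p.proj = q.proj) (hY : p.proj ∉ Y) :
    p.level = q.level := by
  have h1 := p.level_spec
  have h2 := q.level_spec
  rw [← h] at h2
  simp only [mem_union, hY, or_false] at h1 h2
  rcases h1 with h1 | h1 <;> rcases h2 with h2 | h2 <;> simp_all

theorem lt_iff {p q : DoubleArrow Y} : p < q ↔ toLex p.proj < toLex q.proj ∨
    (p.proj = q.proj ∧ p.level = false ∧ q.level = true) := by
  change p.1 < q.1 ↔ _
  rw [Prod.Lex.lt_iff]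
  refine or_congr Iff.rfl (and_congr Iff.rfl ?_)
  change p.level < q.level ↔ _
  cases p.level <;> cases q.level <;> decide

open Classical in
/-- Whether a point lies to the right of the gap at `y`. -/
noncomputable def side (y : ℕ → Bool) (p : DoubleArrow Y) : Bool :=
  decide (toLex y < toLex p.proj ∨ (p.proj = y ∧ p.level = true))

theorem side_eq_true {y : ℕ → Bool} {p : DoubleArrow Y} :
    side y p = true ↔ toLex y < toLex p.proj ∨ (p.proj = y ∧ p.level = true) := by
  simp [side]

theorem side_eq_iff {Y' : Set (ℕ → Bool)} {y y' : ℕ → Bool} {p : DoubleArrow Y}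
    {q : DoubleArrow Y'} : side y p = side y' q ↔
    ((toLex y < toLex p.proj ∨ (p.proj = y ∧ p.level = true)) ↔
      (toLex y' < toLex q.proj ∨ (q.proj = y' ∧ q.level = true))) := by
  rw [← side_eq_true, ← side_eq_true, Bool.eq_iff_iff]

theorem side_proj (p : DoubleArrow Y) : side p.proj p = p.level := by
  rw [Bool.eq_iff_iff, side_eq_true]
  exact ⟨fun h => h.elim (fun h => absurd h (lt_irrefl _)) And.right, fun h => Or.inr ⟨rfl, h⟩⟩

variable (Y) in
/-- The coordinates that separate points: the binary digits and the sides of the gaps. -/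
noncomputable def coord : ℕ ⊕ Y → DoubleArrow Y → Bool
  | .inl i, p => p.proj i
  | .inr y, p => side y p

theorem coord_separating (p q : DoubleArrow Y) (h : ∀ i, coord Y i p = coord Y i q) : p = q := by
  have hpq : p.proj = q.proj := funext fun i => h (.inl i)
  refine ext hpq ?_
  by_cases hY : p.proj ∈ Y
  · have := h (.inr ⟨_, hY⟩)
    simp only [coord] at this
    rwa [side_proj, hpq, side_proj] at this
  · exact level_eq_of_notMem hpq hY

/-- The digits determine every side except the one at the gap of the sequence itself. That bit is
free: as `Y` misses `Q₀`, both levels exist over a point of `Y`. -/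
theorem range_coord (hY : Disjoint Y (eventuallyEq false)) :
    range (fun p i => coord Y i p) = {r : ℕ ⊕ Y → Bool | ∀ y : Y,
      (toLex y.1 < toLex (fun i => r (.inl i)) → r (.inr y) = true) ∧
      (toLex (fun i => r (.inl i)) < toLex y.1 → r (.inr y) = false)} := by
  ext r
  constructor
  · rintro ⟨p, rfl⟩ y
    constructor
    · intro h
      exact side_eq_true.2 (Or.inl h)
    · intro h
      rw [← Bool.not_eq_true]
      change ¬ side y.1 p = true
      rw [side_eq_true]
      rintro (h' | ⟨h', -⟩)
      · exact lt_asymm h h'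
      · exact h.ne (congrArg toLex h')
  · intro hr
    set x : ℕ → Bool := fun i => r (.inl i) with hx
    have key : ∀ p : DoubleArrow Y, p.proj = x → (∀ hx : x ∈ Y, p.level = r (.inr ⟨x, hx⟩)) →
        (fun i => coord Y i p) = r := by
      intro p hp hl
      funext i
      rcases i with i | y
      · exact congrFun hp i
      · change side y.1 p = _
        rcases lt_trichotomy (toLex y.1) (toLex x) with h | h | h
        · rw [(hr y).1 h, side_eq_true, hp]
          exact Or.inl h
        · have h : y.1 = x := h
          have hxY : x ∈ Y := h ▸ y.2
          have hy : y = ⟨x, hxY⟩ := Subtype.ext h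
          rw [hy]
          change side x p = _
          rw [← hl hxY, ← hp, side_proj]
        · rw [(hr y).2 h, ← Bool.not_eq_true, side_eq_true, hp]
          rintro (h' | ⟨h', -⟩)
          · exact lt_asymm h h'
          · exact h.ne (congrArg toLex h')
    by_cases hxY : x ∈ Y
    · refine ⟨mk x (r (.inr ⟨x, hxY⟩)) ?_, key _ rfl fun _ => rfl⟩
      cases r (.inr ⟨x, hxY⟩)
      · exact Or.inl ⟨rfl, disjoint_left.1 hY hxY⟩
      · exact Or.inr ⟨rfl, Or.inr hxY⟩
    · by_cases hx0 : x ∈ eventuallyEq false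
      · exact ⟨mk x true (Or.inr ⟨rfl, Or.inl hx0⟩), key _ rfl fun h => absurd h hxY⟩
      · exact ⟨mk x false (Or.inl ⟨rfl, hx0⟩), key _ rfl fun h => absurd h hxY⟩

theorem isClosed_range_coord (hY : Disjoint Y (eventuallyEq false)) :
    IsClosed (range (fun p i => coord Y i p)) := by
  rw [range_coord hY]
  simp only [ofPred_forall]
  refine isClosed_iInter fun y => ?_
  have hc : Continuous fun (r : ℕ ⊕ Y → Bool) (i : ℕ) => r (.inl i) :=
    continuous_pi fun i => continuous_apply _
  refine IsClosed.and ?_ ?_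
  · exact isClosed_imp ((isOpen_setOf_lex_lt y.1).1.preimage hc)
      (isClosed_eq (continuous_apply _) continuous_const)
  · exact isClosed_imp ((isOpen_setOf_lex_lt y.1).2.preimage hc)
      (isClosed_eq (continuous_apply _) continuous_const)

/-- Either a first differing digit witnesses the inequality, or the two points bound a gap and its
single side coordinate does. -/
theorem exists_finset_coord_Ioi {a p : DoubleArrow Y}
    (h : a < p) : ∃ s : Finset (ℕ ⊕ Y), ∀ q, (∀ i ∈ s, coord Y i q = coord Y i p) → a < q := by
  rcases lt_iff.1 h with h | ⟨h, ha, hp⟩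
  · obtain ⟨i, hi, h0, h1⟩ := lex_lt_iff.1 h
    refine ⟨(Finset.range (i + 1)).map ⟨Sum.inl, Sum.inl_injective⟩, fun q hq => ?_⟩
    have hq : ∀ j ≤ i, q.proj j = p.proj j := fun j hj => hq (.inl j) (by simpa using by omega)
    exact lt_iff.2 (Or.inl (lex_lt_iff.2 ⟨i, fun j hj => by rw [hi j hj, hq j hj.le], h0,
      by rw [hq i le_rfl, h1]⟩))
  · have haY : a.proj ∈ Y := by
      have h1 := a.level_spec
      have h2 := p.level_spec
      rw [← h] at h2
      simp only [ha, hp, mem_union] at h1 h2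
      tauto
    refine ⟨{.inr ⟨_, haY⟩}, fun q hq => ?_⟩
    have hq : side a.proj q = side a.proj p := hq _ (Finset.mem_singleton_self _)
    rw [h, side_proj, hp, side_eq_true, ← h] at hq
    exact lt_iff.2 (hq.imp id fun hq => ⟨hq.1.symm, ha, hq.2⟩)

theorem exists_finset_coord_Iio {a p : DoubleArrow Y}
    (h : p < a) : ∃ s : Finset (ℕ ⊕ Y), ∀ q, (∀ i ∈ s, coord Y i q = coord Y i p) → q < a := by
  rcases lt_iff.1 h with h | ⟨h, hp, ha⟩
  · obtain ⟨i, hi, h0, h1⟩ := lex_lt_iff.1 h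
    refine ⟨(Finset.range (i + 1)).map ⟨Sum.inl, Sum.inl_injective⟩, fun q hq => ?_⟩
    have hq : ∀ j ≤ i, q.proj j = p.proj j := fun j hj => hq (.inl j) (by simpa using by omega)
    exact lt_iff.2 (Or.inl (lex_lt_iff.2 ⟨i, fun j hj => by rw [hq j hj.le, hi j hj],
      by rw [hq i le_rfl, h0], h1⟩))
  · have haY : a.proj ∈ Y := by
      have h1 := a.level_spec
      have h2 := p.level_spec
      rw [h] at h2
      simp only [ha, hp, mem_union] at h1 h2
      tauto
    refine ⟨{.inr ⟨_, haY⟩}, fun q hq => ?_⟩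
    have hq : side a.proj q = side a.proj p := hq _ (Finset.mem_singleton_self _)
    rw [← h, side_proj, hp, ← Bool.not_eq_true, side_eq_true, not_or, h] at hq
    rcases lt_or_eq_of_le (not_lt.1 hq.1) with hlt | heq
    · exact lt_iff.2 (Or.inl hlt)
    · have heq : q.proj = a.proj := heq
      exact lt_iff.2 (Or.inr ⟨heq, by simpa [heq] using hq.2, ha⟩)

/-- The coordinate topology is compact and refines the order topology, which is Hausdorff, so the
two agree. -/
theorem compactSpace_and_continuous_coord (hY : Disjoint Y (eventuallyEq false)) :
    CompactSpace (DoubleArrow Y) ∧ ∀ i, Continuous (coord Y i) := by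
  let e : DoubleArrow Y → (ℕ ⊕ Y → Bool) := fun p i => coord Y i p
  have he : Function.Injective e := fun p q h => coord_separating p q fun i => congrFun h i
  let ψ : range e ≃ DoubleArrow Y := (Equiv.ofInjective e he).symm
  have hψ : ∀ r, e (ψ r) = r.1 := fun r => Equiv.apply_ofInjective_symm he r
  have hopen : ∀ U : Set (DoubleArrow Y), (∀ p ∈ U, ∃ s : Finset (ℕ ⊕ Y), ∀ q,
      (∀ i ∈ s, coord Y i q = coord Y i p) → q ∈ U) → IsOpen (ψ ⁻¹' U) := by
    intro U hU
    refine isOpen_iff_forall_mem_open.2 fun r hr => ?_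
    obtain ⟨s, hs⟩ := hU _ hr
    refine ⟨⋂ i ∈ s, {r' | r'.1 i = r.1 i}, fun r' hr' => hs _ fun i hi => ?_, ?_, ?_⟩
    · have := mem_iInter₂.1 hr' i hi
      change e (ψ r') i = e (ψ r) i
      rw [hψ, hψ, this]
    · exact isOpen_biInter_finset fun i _ => (isClopen_setOf_eq
        ((continuous_apply i).comp continuous_subtype_val) _).isOpen
    · exact mem_iInter₂.2 fun i _ => rfl
  have hcont : Continuous ψ := by
    rw [OrderTopology.continuous_iff]
    exact fun a => ⟨hopen _ fun p hp => exists_finset_coord_Ioi hp,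
      hopen _ fun p hp => exists_finset_coord_Iio hp⟩
  have : CompactSpace (range e) := isCompact_iff_compactSpace.1 (isClosed_range_coord hY).isCompact
  let Φ : range e ≃ₜ DoubleArrow Y := hcont.homeoOfEquivCompactToT2
  refine ⟨Φ.compactSpace, fun i => ?_⟩
  have : coord Y i = (fun r : range e => r.1 i) ∘ Φ.symm := by
    funext p
    change e p i = _
    obtain ⟨r, rfl⟩ := Φ.surjective p
    simp only [Function.comp, Φ.symm_apply_apply]
    exact congrFun (hψ r) i
  rw [this]
  exact ((continuous_apply i).comp continuous_subtype_val).comp Φ.symm.continuous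

end DoubleArrow

/-- Two disjoint homeomorphic clopen sets can be swapped. -/
theorem exists_homeomorph_swap {X : Type*} [TopologicalSpace X] {W W' : Set X} (hW : IsClopen W)
    (hW' : IsClopen W') (hd : Disjoint W W') {f g : X → X} (hf : MapsTo f W W')
    (hg : MapsTo g W' W) (hgf : LeftInvOn g f W) (hfg : LeftInvOn f g W')
    (cf : ∀ p ∈ W, ContinuousAt f p) (cg : ∀ p ∈ W', ContinuousAt g p) :
    ∃ u : X ≃ₜ X, EqOn u f W ∧ EqOn u g W' ∧ ∀ p, p ∉ W → p ∉ W' → u p = p := by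
  classical
  let u : X → X := fun p => if p ∈ W then f p else if p ∈ W' then g p else p
  have u1 : EqOn u f W := fun p hp => if_pos hp
  have u2 : EqOn u g W' := fun p hp => by
    simp only [u, if_neg (disjoint_right.1 hd hp), if_pos hp]
  have u3 : ∀ p, p ∉ W → p ∉ W' → u p = p := fun p h h' => by simp only [u, if_neg h, if_neg h']
  have huu : ∀ p, u (u p) = p := by
    intro p
    by_cases hp : p ∈ W
    · rw [u1 hp, u2 (hf hp), hgf hp]
    by_cases hp' : p ∈ W'
    · rw [u2 hp', u1 (hg hp'), hfg hp']
    rw [u3 p hp hp', u3 p hp hp']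
  have huc : Continuous u := by
    rw [continuous_iff_continuousAt]
    intro p
    by_cases hp : p ∈ W
    · exact (cf p hp).congr (eventuallyEq_of_mem (hW.isOpen.mem_nhds hp) u1.symm)
    by_cases hp' : p ∈ W'
    · exact (cg p hp').congr (eventuallyEq_of_mem (hW'.isOpen.mem_nhds hp') u2.symm)
    refine continuousAt_id.congr (eventuallyEq_of_mem
      ((hW.compl.isOpen.inter hW'.compl.isOpen).mem_nhds ⟨hp, hp'⟩) fun q hq => ?_)
    exact (u3 q hq.1 hq.2).symm
  exact ⟨⟨⟨u, u, huu, huu⟩, huc, huc⟩, u1, u2, u3⟩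

theorem exists_bijection_of_infinite {A B : Set ℕ} (hA : A.Infinite) (hB : B.Infinite) :
    ∃ σ τ : ℕ → ℕ, MapsTo σ A B ∧ MapsTo τ B A ∧ LeftInvOn τ σ A ∧ LeftInvOn σ τ B := by
  classical
  have := hA.to_subtype
  have := hB.to_subtype
  let := Nat.Subtype.denumerable A
  let := Nat.Subtype.denumerable B
  let e : A ≃ B := Denumerable.equiv₂ A B
  refine ⟨fun n => if h : n ∈ A then e ⟨n, h⟩ else n, fun n => if h : n ∈ B then e.symm ⟨n, h⟩ else n,
    fun n hn => ?_, fun n hn => ?_, fun n hn => ?_, fun n hn => ?_⟩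
  all_goals simp [hn]

theorem exists_le_of_injOn {A : Set ℕ} {σ : ℕ → ℕ} (hσ : InjOn σ A) (M : ℕ) :
    ∃ N, ∀ n ∈ A, N ≤ n → M ≤ σ n := by
  have hfin : (A ∩ σ ⁻¹' Iio M).Finite :=
    Finite.of_finite_image ((finite_Iio M).subset (by rintro _ ⟨n, hn, rfl⟩; exact hn.2))
      (hσ.mono inter_subset_left)
  obtain ⟨N, hN⟩ := hfin.bddAbove
  refine ⟨N + 1, fun n hn hle => ?_⟩
  by_contra! hlt
  have := hN ⟨hn, hlt⟩
  omega

theorem firstDiff_eq_of_agree {x y : ℕ → Bool} {n : ℕ} (h : ∀ i < n, y i = x i) (hn : y n ≠ x n) :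
    PiNat.firstDiff x y = n := by
  have hne : x ≠ y := fun h => hn (congrFun h n).symm
  refine le_antisymm ?_ ?_
  · by_contra! hlt
    exact hn (PiNat.apply_eq_of_lt_firstDiff hlt).symm
  · by_contra! hlt
    exact PiNat.apply_firstDiff_ne hne (h _ hlt).symm

theorem graft_lt_graft_iff {a b : ℕ → Bool} {k n : ℕ} {y z : ℕ → Bool} (hy : ∀ i < n, y i = b i)
    (hz : ∀ i < n, z i = b i) :
    toLex (graft a k n y) < toLex (graft a k n z) ↔ toLex y < toLex z := by
  refine ⟨fun h => ?_, graft_lt_graft hy hz⟩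
  have := graft_lt_graft (a := b) (k := n) (b := a) (n := k)
    (fun i hi => graft_apply_of_lt a n y hi) (fun i hi => graft_apply_of_lt a n z hi) h
  rwa [graft_graft _ _ _ _ _ hy, graft_graft _ _ _ _ _ hz] at this

/-! ### Fans and the maps between them. -/

namespace DoubleArrow

variable {Y : Set (ℕ → Bool)}

theorem side_eq_of_agree {y : ℕ → Bool} {p q : DoubleArrow Y} {n : ℕ}
    (h : ∀ i < n, q.proj i = p.proj i) (hy : ∃ i < n, y i ≠ p.proj i) : side y q = side y p := by
  rw [side_eq_iff, lex_lt_iff_of_agree h hy]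
  obtain ⟨i, hi, hne⟩ := hy
  have h1 : p.proj ≠ y := fun h => hne (congrFun h i).symm
  have h2 : q.proj ≠ y := fun h' => hne (by rw [← h', h i hi])
  simp [h1, h2]

/-- Replace an initial segment of the first coordinate. -/
def graftMap (hs : IsSaturated Y) (a : ℕ → Bool) (k n : ℕ) (p : DoubleArrow Y) : DoubleArrow Y :=
  mk (graft a k n p.proj) p.level <| by
    have h := tailEquiv_graft a k n p.proj
    rw [mem_union, hs.mem_iff h, (isSaturated_eventuallyEq false).mem_iff h]
    exact p.level_spec

theorem graftMap_graftMap (hs : IsSaturated Y) {a b : ℕ → Bool} {k n : ℕ} {p : DoubleArrow Y}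
    (hp : ∀ i < n, p.proj i = b i) : graftMap hs b n k (graftMap hs a k n p) = p :=
  ext (graft_graft a b k n p.proj hp) rfl

/-- The points agreeing with `d` up to `m` and lying on the same side of the gap next to `d`,
if there is one. -/
def fan (d : DoubleArrow Y) (m : ℕ) : Set (DoubleArrow Y) :=
  {p | (∀ i < m, p.proj i = d.proj i) ∧ (d.proj ∈ Y → side d.proj p = d.level)}

/-- The lengths at which points of `fan d m` may branch off from `d`. -/
def branch (d : DoubleArrow Y) (m : ℕ) : Set ℕ :=
  {n | m ≤ n ∧ (d.proj ∈ Y → d.proj n ≠ d.level)}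

theorem mem_fan_self (d : DoubleArrow Y) (m : ℕ) : d ∈ fan d m :=
  ⟨fun _ _ => rfl, fun _ => side_proj d⟩

theorem fan_antitone (d : DoubleArrow Y) : Antitone (fan d) :=
  fun _ _ h _ hp => ⟨fun i hi => hp.1 i (hi.trans_le h), hp.2⟩

theorem proj_ne_of_mem_fan {d p : DoubleArrow Y} {m : ℕ} (hp : p ∈ fan d m) (hne : p ≠ d) :
    p.proj ≠ d.proj := by
  intro h
  refine hne (ext h ?_)
  by_cases hY : d.proj ∈ Y
  · rw [← hp.2 hY, ← h, side_proj]
  · exact level_eq_of_notMem h (h ▸ hY)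

theorem side_eq_not_of_agree {d p : DoubleArrow Y} {n : ℕ} (h : ∀ i < n, p.proj i = d.proj i)
    (hn : p.proj n ≠ d.proj n) : side d.proj p = !d.proj n := by
  cases hd : d.proj n
  · rw [hd, ne_eq, Bool.not_eq_false] at hn
    exact side_eq_true.2 (Or.inl (lex_lt_iff.2 ⟨n, fun j hj => (h j hj).symm, hd, hn⟩))
  · rw [hd, ne_eq, Bool.not_eq_true] at hn
    have hlt : toLex p.proj < toLex d.proj := lex_lt_iff.2 ⟨n, h, hn, hd⟩
    change side d.proj p = false
    rw [← Bool.not_eq_true, side_eq_true]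
    rintro (h' | ⟨h', -⟩)
    · exact lt_asymm h' hlt
    · exact hlt.ne (congrArg toLex h')

/-- A point leaving `d` at `n` goes right exactly when digit `n` of `d` is 0. To stay on the side of
`d`, that digit must differ from the level. -/
theorem mem_fan_iff_mem_branch {d p : DoubleArrow Y} {m n : ℕ}
    (h : ∀ i < n, p.proj i = d.proj i) (hn : p.proj n ≠ d.proj n) :
    p ∈ fan d m ↔ n ∈ branch d m := by
  refine and_congr ⟨fun h' => ?_, fun h' i hi => h i (hi.trans_le h')⟩ ?_
  · by_contra! hlt
    exact hn (h' n hlt)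
  · rw [side_eq_not_of_agree h hn]
    cases d.proj n <;> cases d.level <;> simp

theorem firstDiff_spec {d p : DoubleArrow Y} {m : ℕ} (hp : p ∈ fan d m) (hne : p ≠ d) :
    (∀ i < PiNat.firstDiff d.proj p.proj, p.proj i = d.proj i) ∧
      p.proj (PiNat.firstDiff d.proj p.proj) ≠ d.proj (PiNat.firstDiff d.proj p.proj) :=
  ⟨fun _ hi => (PiNat.apply_eq_of_lt_firstDiff hi).symm,
    (PiNat.apply_firstDiff_ne (proj_ne_of_mem_fan hp hne).symm).symm⟩

/-- With finitely many branches, `d.proj` would lie in `Y` and be eventually equal to the level of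
`d`; this is where `Y` must miss both `Q₀` and `Q₁`. -/
theorem infinite_branch (hY0 : Disjoint Y (eventuallyEq false))
    (hY1 : Disjoint Y (eventuallyEq true)) (d : DoubleArrow Y) (m : ℕ) :
    (branch d m).Infinite := by
  refine infinite_of_forall_exists_gt fun a => ?_
  by_contra! hcon
  have h : ∀ n, a + m < n → d.proj ∈ Y ∧ d.proj n = d.level := by
    intro n hn
    have : n ∉ branch d m := fun h => absurd (hcon n h) (by omega)
    by_contra hh
    exact this ⟨by omega, fun h1 h2 => hh ⟨h1, h2⟩⟩
  have hd : d.proj ∈ Y := (h (a + m + 1) (by omega)).1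
  have hev : d.proj ∈ eventuallyEq d.level := ⟨a + m + 1, fun n hn => (h n (by omega)).2⟩
  cases hl : d.level
  · exact disjoint_left.1 hY0 hd (hl ▸ hev)
  · exact disjoint_left.1 hY1 hd (hl ▸ hev)

open Classical in
/-- The map of `fan d m` to `fan e l` that sends `d` to `e` and sends the points that branch off
from `d` at `n` to points that branch off from `e` at `σ n`. -/
noncomputable def fanMap (hs : IsSaturated Y) (d e : DoubleArrow Y) (σ : ℕ → ℕ)
    (p : DoubleArrow Y) : DoubleArrow Y :=
  if p = d then e else
    graftMap hs (Function.update e.proj (σ (PiNat.firstDiff d.proj p.proj))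
      (!e.proj (σ (PiNat.firstDiff d.proj p.proj))))
      (σ (PiNat.firstDiff d.proj p.proj) + 1) (PiNat.firstDiff d.proj p.proj + 1) p

theorem fanMap_self (hs : IsSaturated Y) (d e : DoubleArrow Y) (σ : ℕ → ℕ) :
    fanMap hs d e σ d = e := if_pos rfl

theorem fanMap_of_agree (hs : IsSaturated Y) {d e p : DoubleArrow Y} (σ : ℕ → ℕ) {n : ℕ}
    (h : ∀ i < n, p.proj i = d.proj i) (hn : p.proj n ≠ d.proj n) :
    fanMap hs d e σ p =
      graftMap hs (Function.update e.proj (σ n) (!e.proj (σ n))) (σ n + 1) (n + 1) p := by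
  have hne : p ≠ d := fun h => hn (by rw [h])
  rw [fanMap, if_neg hne, firstDiff_eq_of_agree h hn]

theorem fanMap_agree (hs : IsSaturated Y) {d e p : DoubleArrow Y} (σ : ℕ → ℕ) {n : ℕ}
    (h : ∀ i < n, p.proj i = d.proj i) (hn : p.proj n ≠ d.proj n) :
    (∀ i < σ n, (fanMap hs d e σ p).proj i = e.proj i) ∧
      (fanMap hs d e σ p).proj (σ n) ≠ e.proj (σ n) := by
  rw [fanMap_of_agree hs σ h hn]
  constructor
  · intro i hi
    change graft _ _ _ _ i = _
    rw [graft_apply_of_lt _ _ _ (by omega), Function.update_of_ne hi.ne]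
  · change graft _ _ _ _ (σ n) ≠ _
    rw [graft_apply_of_lt _ _ _ (by omega), Function.update_self]
    simp

theorem tailEquiv_fanMap (hs : IsSaturated Y) {d e p : DoubleArrow Y} (σ : ℕ → ℕ) (h : p ≠ d) :
    TailEquiv (fanMap hs d e σ p).proj p.proj := by
  rw [fanMap, if_neg h]
  exact tailEquiv_graft _ _ _ _

theorem mapsTo_fanMap (hs : IsSaturated Y) {d e : DoubleArrow Y} {σ : ℕ → ℕ} {m l : ℕ}
    (hσ : MapsTo σ (branch d m) (branch e l)) : MapsTo (fanMap hs d e σ) (fan d m) (fan e l) := by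
  intro p hp
  by_cases hpd : p = d
  · rw [hpd, fanMap_self]
    exact mem_fan_self e l
  obtain ⟨h, hn⟩ := firstDiff_spec hp hpd
  obtain ⟨h', hn'⟩ := fanMap_agree hs (e := e) σ h hn
  exact (mem_fan_iff_mem_branch h' hn').2 (hσ ((mem_fan_iff_mem_branch h hn).1 hp))

theorem leftInvOn_fanMap (hs : IsSaturated Y) {d e : DoubleArrow Y} {σ τ : ℕ → ℕ} {m : ℕ}
    (hτσ : LeftInvOn τ σ (branch d m)) :
    LeftInvOn (fanMap hs e d τ) (fanMap hs d e σ) (fan d m) := by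
  intro p hp
  by_cases hpd : p = d
  · rw [hpd, fanMap_self, fanMap_self]
  obtain ⟨h, hn⟩ := firstDiff_spec hp hpd
  obtain ⟨h', hn'⟩ := fanMap_agree hs (e := e) σ h hn
  rw [fanMap_of_agree hs τ h' hn', hτσ ((mem_fan_iff_mem_branch h hn).1 hp),
    fanMap_of_agree hs σ h hn]
  refine graftMap_graftMap hs fun i hi => ?_
  rcases Nat.lt_succ_iff_lt_or_eq.1 hi with hi | rfl
  · rw [h i hi, Function.update_of_ne hi.ne]
  · rw [Function.update_self]
    exact Bool.eq_not.2 hn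

/-! ### Continuity, local movability and countable dense homogeneity. -/

section Topology

variable (hY0 : Disjoint Y (eventuallyEq false))

include hY0

theorem isInducing_coord : IsInducing (fun (p : DoubleArrow Y) i => coord Y i p) :=
  have := (compactSpace_and_continuous_coord hY0).1
  (isClosedEmbedding_of_separating (compactSpace_and_continuous_coord hY0).2
    coord_separating).isInducing

theorem continuous_coord (i : ℕ ⊕ Y) : Continuous (coord Y i) :=
  (compactSpace_and_continuous_coord hY0).2 i

theorem continuous_proj : Continuous (proj : DoubleArrow Y → ℕ → Bool) :=
  continuous_pi fun i => continuous_coord hY0 (.inl i)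

theorem continuous_side {y : ℕ → Bool} (hy : y ∈ Y) :
    Continuous (side y : DoubleArrow Y → Bool) :=
  continuous_coord hY0 (.inr ⟨y, hy⟩)

theorem isClopen_agree (x : ℕ → Bool) (n : ℕ) :
    IsClopen {p : DoubleArrow Y | ∀ i < n, p.proj i = x i} := by
  have : {p : DoubleArrow Y | ∀ i < n, p.proj i = x i} =
      ⋂ i ∈ Iio n, {p : DoubleArrow Y | p.proj i = x i} := by
    ext; simp
  rw [this]
  exact (finite_Iio n).isClopen_biInter fun i _ => isClopen_setOf_eq (continuous_coord hY0 (.inl i)) _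

/-- Pulled back along the graft, the side of `y` is the side of another gap of `Y` (by saturation)
if `y` begins with the new prefix, and is locally constant otherwise. -/
theorem continuousAt_graftMap (hs : IsSaturated Y) (a : ℕ → Bool) (k n : ℕ) (p : DoubleArrow Y) :
    ContinuousAt (graftMap hs a k n) p := by
  rw [(isInducing_coord hY0).continuousAt_iff, continuousAt_pi]
  rintro (i | ⟨y, hy⟩)
  · exact ((continuous_apply i).comp
      ((continuous_graft a k n).comp (continuous_proj hY0))).continuousAt
  have hnhds := (isClopen_agree hY0 p.proj n).isOpen.mem_nhds (x := p) fun _ _ => rfl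
  by_cases hya : ∀ i < k, y i = a i
  · set y' := graft p.proj n k y with hy'
    have hyy' : graft a k n y' = y := graft_graft _ _ _ _ _ hya
    have hagree : ∀ i < n, y' i = p.proj i := fun i hi => graft_apply_of_lt _ _ _ hi
    have hyY : y' ∈ Y := hs.mem_of_tailEquiv (tailEquiv_graft _ _ _ _) hy
    refine (continuous_side hY0 hyY).continuousAt.congr (eventuallyEq_of_mem hnhds fun q hq => ?_)
    change side y' q = side y (graftMap hs a k n q)
    rw [side_eq_iff]
    change _ ↔ toLex y < toLex (graft a k n q.proj) ∨ graft a k n q.proj = y ∧ q.level = true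
    have h1 := graft_lt_graft_iff (a := a) (k := k) hagree hq
    rw [hyy'] at h1
    rw [h1]
    refine or_congr Iff.rfl (and_congr ⟨fun h => by rw [h, hyy'], fun h => ?_⟩ Iff.rfl)
    rw [hy', ← h, graft_graft _ _ _ _ _ hq]
  · push Not at hya
    refine (continuousAt_const (y := side y (graftMap hs a k n p))).congr
      (eventuallyEq_of_mem hnhds fun q hq => ?_)
    refine (side_eq_of_agree (n := k) (fun i hi => ?_) ?_).symm
    · change graft _ _ _ _ i = graft _ _ _ _ i
      rw [graft_apply_of_lt _ _ _ hi, graft_apply_of_lt _ _ _ hi]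
    · obtain ⟨i, hi, hne⟩ := hya
      refine ⟨i, hi, ?_⟩
      change _ ≠ graft _ _ _ _ i
      rwa [graft_apply_of_lt _ _ _ hi]

theorem isClopen_fan (d : DoubleArrow Y) (m : ℕ) : IsClopen (fan d m) := by
  refine (isClopen_agree hY0 d.proj m).inter (t := {p | d.proj ∈ Y → side d.proj p = d.level}) ?_
  by_cases hd : d.proj ∈ Y
  · simpa only [hd, forall_true_left] using isClopen_setOf_eq (continuous_side hY0 hd) d.level
  · simp [hd, isClopen_univ]

/-- The fans at `d` are nested compact sets whose intersection is `{d}`. -/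
theorem exists_fan_subset {d : DoubleArrow Y} {O : Set (DoubleArrow Y)} (hO : O ∈ 𝓝 d) :
    ∃ m, fan d m ⊆ O := by
  have := (compactSpace_and_continuous_coord hY0).1
  refine exists_subset_nhds_of_isCompact' (fan_antitone d).directed_ge
    (fun m => (isClopen_fan hY0 d m).isClosed.isCompact)
    (fun m => (isClopen_fan hY0 d m).isClosed) fun p hp => ?_
  have hp : ∀ m, p ∈ fan d m := fun m => mem_iInter.1 hp m
  by_cases hpd : p = d
  · rwa [hpd]
  · exact absurd (funext fun i => (hp (i + 1)).1 i (Nat.lt_succ_self i))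
      (proj_ne_of_mem_fan (hp 0) hpd)

/-- At the centre, injectivity of `σ` sends long branches to long branches. Elsewhere the map is
locally a single graft. -/
theorem continuousAt_fanMap (hs : IsSaturated Y) {d e p : DoubleArrow Y} {σ : ℕ → ℕ} {m l : ℕ}
    (hσ : MapsTo σ (branch d m) (branch e l)) (hinj : InjOn σ (branch d m)) (hp : p ∈ fan d m) :
    ContinuousAt (fanMap hs d e σ) p := by
  by_cases hpd : p = d
  · subst hpd
    rw [ContinuousAt, fanMap_self]
    intro O hO
    obtain ⟨M, hM⟩ := exists_fan_subset hY0 hO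
    obtain ⟨N, hN⟩ := exists_le_of_injOn hinj M
    rw [mem_map]
    refine mem_of_superset ((isClopen_fan hY0 p (max N m)).isOpen.mem_nhds (mem_fan_self p _))
      fun q hq => hM ?_
    by_cases hqp : q = p
    · rw [hqp, fanMap_self]
      exact mem_fan_self e M
    obtain ⟨h, hn⟩ := firstDiff_spec hq hqp
    obtain ⟨h', hn'⟩ := fanMap_agree hs (e := e) σ h hn
    have hb := (mem_fan_iff_mem_branch h hn).1 hq
    have hb' : _ ∈ branch p m := ⟨(le_max_right _ _).trans hb.1, hb.2⟩
    exact (mem_fan_iff_mem_branch h' hn').2 ⟨hN _ hb' ((le_max_left _ _).trans hb.1), (hσ hb').2⟩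
  · obtain ⟨h, hn⟩ := firstDiff_spec hp hpd
    set n := PiNat.firstDiff d.proj p.proj
    refine (continuousAt_graftMap hY0 hs (Function.update e.proj (σ n) (!e.proj (σ n)))
      (σ n + 1) (n + 1) p).congr (eventuallyEq_of_mem
      ((isClopen_agree hY0 p.proj (n + 1)).isOpen.mem_nhds
        fun _ _ => rfl) fun q hq => ?_)
    refine (fanMap_of_agree hs σ (n := n) (fun i hi => ?_) ?_).symm
    · rw [hq i (by omega), h i hi]
    · rwa [hq _ (by omega)]

/-- Swap small disjoint fans at `d` and `e`. All other points move within their tail class, so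
membership over `C` is kept; `d` and `e` need not be tail equivalent, but both lie over `C`. -/
theorem locallyMovable (hs : IsSaturated Y) (hY1 : Disjoint Y (eventuallyEq true))
    {C : Set (ℕ → Bool)} (hC : IsSaturated C) :
    LocallyMovable (proj ⁻¹' C : Set (DoubleArrow Y)) := by
  rintro U hU d ⟨hdU, hdC⟩ e ⟨heU, heC⟩
  by_cases hde : d = e
  · exact ⟨Homeomorph.refl _, hde, fun _ _ => rfl, fun _ => Iff.rfl⟩
  obtain ⟨O, O', hO, hO', hdO, heO', hdisj⟩ := t2_separation hde
  obtain ⟨m, hm⟩ := exists_fan_subset hY0 ((hU.inter hO).mem_nhds ⟨hdU, hdO⟩)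
  obtain ⟨l, hl⟩ := exists_fan_subset hY0 ((hU.inter hO').mem_nhds ⟨heU, heO'⟩)
  obtain ⟨σ, τ, hσ, hτ, hτσ, hστ⟩ := exists_bijection_of_infinite
    (infinite_branch hY0 hY1 d m) (infinite_branch hY0 hY1 e l)
  obtain ⟨u, u1, u2, u3⟩ := exists_homeomorph_swap (isClopen_fan hY0 d m) (isClopen_fan hY0 e l)
    (hdisj.mono (fun _ h => (hm h).2) fun _ h => (hl h).2)
    (mapsTo_fanMap hs hσ) (mapsTo_fanMap hs hτ) (leftInvOn_fanMap hs hτσ)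
    (leftInvOn_fanMap hs hστ) (fun p hp => continuousAt_fanMap hY0 hs hσ hτσ.injOn hp)
    (fun p hp => continuousAt_fanMap hY0 hs hτ hστ.injOn hp)
  refine ⟨u, ?_, fun p hp => u3 p (fun h => hp (hm h).1) fun h => hp (hl h).1, fun p => ?_⟩
  · rw [u1 (mem_fan_self d m), fanMap_self]
  · rw [mem_preimage, mem_preimage]
    by_cases hpd : p ∈ fan d m
    · rw [u1 hpd]
      by_cases h : p = d
      · rw [h, fanMap_self]
        exact iff_of_true heC hdC
      · exact hC.mem_iff (tailEquiv_fanMap hs σ h)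
    by_cases hpe : p ∈ fan e l
    · rw [u2 hpe]
      by_cases h : p = e
      · rw [h, fanMap_self]
        exact iff_of_true hdC heC
      · exact hC.mem_iff (tailEquiv_fanMap hs τ h)
    rw [u3 p hpd hpe]

theorem separableSpace (hY1 : Disjoint Y (eventuallyEq true)) :
    TopologicalSpace.SeparableSpace (DoubleArrow Y) := by
  refine ⟨⟨{p | p.proj ∈ eventuallyEq true}, ?_, ?_⟩⟩
  · have hinj : Function.Injective fun p : DoubleArrow Y => (p.proj, p.level) :=
      fun p q h => ext (congrArg Prod.fst h) (congrArg Prod.snd h)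
    refine (((countable_eventuallyEq true).prod (countable_univ (α := Bool))).preimage hinj).mono ?_
    exact fun p hp => ⟨hp, trivial⟩
  · refine dense_iff_inter_open.2 fun O hO ⟨d, hd⟩ => ?_
    obtain ⟨m, hm⟩ := exists_fan_subset hY0 (hO.mem_nhds hd)
    obtain ⟨n, hn⟩ := (infinite_branch hY0 hY1 d m).nonempty
    -- Leave `d` at an allowed branch and continue with ones; this avoids `Q₀`, so level 0 is
    -- available.
    let x : ℕ → Bool := fun i => if i < n then d.proj i else if i = n then !d.proj n else true
    have hx : ∀ i, n < i → x i = true := fun i hi => by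
      simp [x, not_lt.2 hi.le, hi.ne']
    have hx0 : x ∉ eventuallyEq false := by
      rintro ⟨N, hN⟩
      have := hN (N + n + 1) (by omega)
      rw [hx _ (by omega)] at this
      exact absurd this (by decide)
    refine ⟨mk x false (Or.inl ⟨rfl, hx0⟩), hm ?_, n + 1, fun i hi => hx i hi⟩
    refine (mem_fan_iff_mem_branch (n := n) (fun i hi => ?_) ?_).2 hn
    · simp [x, hi]
    · simp [x]

theorem isCDH (hs : IsSaturated Y) (hY1 : Disjoint Y (eventuallyEq true))
    (hl : IsLambdaPrimeSet Y) : IsCDH (DoubleArrow Y) := by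
  refine ⟨separableSpace hY0 hY1, fun D E hDc hDd hEc hEd => ?_⟩
  have := (compactSpace_and_continuous_coord hY0).1
  set C : Set (ℕ → Bool) := saturation (proj '' (D ∪ E)) with hC
  have hCc : C.Countable := countable_saturation ((hDc.union hEc).image _)
  have hsub : D ∪ E ⊆ (proj ⁻¹' C : Set (DoubleArrow Y)) := fun p hp =>
    subset_saturation _ (mem_image_of_mem _ hp)
  obtain ⟨f, hf, hfC⟩ := isGδ_iff_eq_iInter_nat.1 (hl C hCc)
  choose V hV hVf using fun n => isOpen_induced_iff.1 (hf n)
  have hVC : ∀ n, C ⊆ V n := by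
    intro n c hc
    have h1 : (⟨c, Or.inr hc⟩ : (Y ∪ C : Set (ℕ → Bool))) ∈ ⋂ n, f n := by
      rw [← hfC]; exact hc
    have h2 := mem_iInter.1 h1 n
    rw [← hVf n] at h2
    exact h2
  have hYV : ∀ y ∈ Y, y ∉ C → ∃ n, y ∉ V n := by
    intro y hy hyC
    by_contra! hcon
    have h1 : (⟨y, Or.inl hy⟩ : (Y ∪ C : Set (ℕ → Bool))) ∈ ⋂ n, f n :=
      mem_iInter.2 fun n => by rw [← hVf n]; exact hcon n
    rw [← hfC] at h1
    exact hyC h1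
  obtain ⟨s, hsC⟩ := countable_iff_exists_subset_range.1 hCc
  -- Gaps off `C` are captured by some `V k`; the countably many on `C` are added one at a time
  -- through `s`.
  let I : ℕ → Set (ℕ ⊕ Y) := fun n =>
    {i | ∃ k < n, Sum.elim (fun j => j = k) (fun y => y.1 ∉ V k ∨ y.1 = s k) i}
  refine exists_homeomorph_image_eq (I := I) (P := proj ⁻¹' C) (continuous_coord hY0)
    coord_separating ?_ ?_ (locallyMovable hY0 hs hY1 (isSaturated_saturation _)) ?_
    (subset_union_left.trans hsub) (subset_union_right.trans hsub) hDc hEc hDd hEd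
  · rintro a b hab i ⟨k, hk, h⟩
    exact ⟨k, hk.trans_le hab, h⟩
  · rintro (i | ⟨y, hy⟩)
    · exact ⟨i + 1, i, Nat.lt_succ_self i, rfl⟩
    · by_cases hyC : y ∈ C
      · obtain ⟨k, rfl⟩ := hsC hyC
        exact ⟨k + 1, k, Nat.lt_succ_self k, Or.inr rfl⟩
      · obtain ⟨k, hk⟩ := hYV y hy hyC
        exact ⟨k + 1, k, Nat.lt_succ_self k, Or.inl hk⟩
  · intro n p hp
    have hcl : IsClosed (⋃ k ∈ Iio n, (V k)ᶜ) :=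
      (finite_Iio n).isClosed_biUnion fun k _ => (hV k).isClosed_compl
    have hpcl : p.proj ∉ ⋃ k ∈ Iio n, (V k)ᶜ := by
      simp only [mem_iUnion, not_exists]
      exact fun k _ h => h (hVC k hp)
    obtain ⟨N, hN⟩ := PiNat.exists_disjoint_cylinder hcl hpcl
    -- Length `n` fixes the digits, length `N` the gaps outside some `V k`; the finitely many gaps
    -- `s k` are fixed by hand.
    refine ⟨{q | ∀ i < max N n, q.proj i = p.proj i} ∩
      ⋂ k ∈ Iio n, {q | s k ∈ Y → side (s k) q = side (s k) p}, ?_, ?_, ?_⟩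
    · refine (isClopen_agree hY0 _ _).isOpen.inter ((finite_Iio n).isOpen_biInter fun k _ => ?_)
      by_cases hk : s k ∈ Y
      · simpa only [hk, forall_true_left] using
          (isClopen_setOf_eq (continuous_side hY0 hk) _).isOpen
      · simp [hk]
    · exact ⟨fun _ _ => rfl, mem_iInter₂.2 fun _ _ _ => rfl⟩
    · rintro (i | ⟨y, hy⟩) ⟨k, hk, h⟩ q ⟨hq1, hq2⟩
      · have h : i = k := h
        exact hq1 i (h ▸ hk.trans_le (le_max_right _ _))
      · rcases h with h | h
        · have hyc : y ∉ PiNat.cylinder p.proj N :=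
            disjoint_left.1 hN (mem_iUnion₂.2 ⟨k, hk, h⟩)
          rw [PiNat.mem_cylinder_iff] at hyc
          push Not at hyc
          obtain ⟨i, hi, hne⟩ := hyc
          exact side_eq_of_agree hq1 ⟨i, hi.trans_le (le_max_left _ _), hne⟩
        · have h : y = s k := h
          subst h
          exact mem_iInter₂.1 hq2 k hk hy

end Topology

end DoubleArrow

/-! ### Weight -/

theorem weight_le {X : Type} [TopologicalSpace X] {B : Set (Set X)}
    (hB : TopologicalSpace.IsTopologicalBasis B) : weight X ≤ #B :=
  csInf_le' ⟨B, hB, rfl⟩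

theorem le_weight {X : Type} [TopologicalSpace X] {κ : Cardinal.{0}}
    (h : ∀ B : Set (Set X), TopologicalSpace.IsTopologicalBasis B → κ ≤ #B) : κ ≤ weight X := by
  refine le_csInf ⟨_, _, TopologicalSpace.isTopologicalBasis_opens, rfl⟩ ?_
  rintro _ ⟨B, hB, rfl⟩
  exact h B hB

theorem weight_eq_mk_of_discrete (X : Type) [TopologicalSpace X] [DiscreteTopology X] :
    weight X = #X := by
  refine le_antisymm ?_ (le_weight fun B hB => ?_)
  · refine (weight_le (B := range fun x : X => {x}) ?_).trans mk_range_le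
    refine TopologicalSpace.isTopologicalBasis_of_isOpen_of_nhds (fun _ _ => isOpen_discrete _) ?_
    exact fun x U hx _ => ⟨{x}, mem_range_self x, rfl, singleton_subset_iff.2 hx⟩
  · have : ∀ x : X, {x} ∈ B := fun x => by
      obtain ⟨U, hU, hxU, hUx⟩ := hB.exists_subset_of_mem_open (mem_singleton x)
        (isOpen_discrete {x})
      rwa [← (subset_singleton_iff_eq.1 hUx).resolve_left (nonempty_of_mem hxU).ne_empty]
    exact mk_le_of_injective (f := fun x => (⟨{x}, this x⟩ : B))
      fun x y h => singleton_injective (congrArg Subtype.val h)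

/-- Finite intersections of coordinate sets form a base. -/
theorem weight_le_of_separating {X ι : Type} [TopologicalSpace X] [CompactSpace X] [Infinite ι]
    {χ : ι → X → Bool} (hχ : ∀ i, Continuous (χ i))
    (hsep : ∀ x y, (∀ i, χ i x = χ i y) → x = y) : weight X ≤ #ι := by
  have hB : TopologicalSpace.IsTopologicalBasis
      (range fun s : Finset (ι × Bool) => {x | ∀ q ∈ s, χ q.1 x = q.2}) := by
    refine TopologicalSpace.isTopologicalBasis_of_isOpen_of_nhds ?_ fun x U hx hU => ?_
    · rintro _ ⟨s, rfl⟩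
      have : {x | ∀ q ∈ s, χ q.1 x = q.2} = ⋂ q ∈ s, {x | χ q.1 x = q.2} := by
        ext; simp
      change IsOpen {x | ∀ q ∈ s, χ q.1 x = q.2}
      rw [this]
      exact isOpen_biInter_finset fun q _ => (isClopen_setOf_eq (hχ q.1) q.2).isOpen
    · obtain ⟨s, hs⟩ := hU.isClosed_compl.isCompact.elim_finite_subcover
        (fun i => {z | χ i z = χ i x}ᶜ) (fun i => (isClopen_setOf_eq (hχ i) _).compl.isOpen)
        (fun z hz => by
          by_contra hcon
          simp only [mem_iUnion, mem_compl_iff, not_exists, not_not] at hcon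
          exact hz (hsep z x hcon ▸ hx))
      refine ⟨_, ⟨s.map ⟨fun i => (i, χ i x), fun i j h => congrArg Prod.fst h⟩, rfl⟩, ?_, ?_⟩
      · intro q hq
        obtain ⟨i, _, rfl⟩ := Finset.mem_map.1 hq
        rfl
      · intro z hz
        by_contra hzU
        obtain ⟨i, hi, hne⟩ := mem_iUnion₂.1 (hs hzU)
        exact hne (hz (i, χ i x) (Finset.mem_map_of_mem _ hi))
  refine (weight_le hB).trans (mk_range_le.trans ?_)
  rw [mk_finset_of_infinite, mk_prod, lift_id, lift_id, mk_bool]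
  exact (mul_eq_left (aleph0_le_mk ι) ((natCast_lt_aleph0 (n := 2)).le.trans (aleph0_le_mk ι))
    two_ne_zero).le

namespace DoubleArrow

variable {Y : Set (ℕ → Bool)}

/-- The left point of the gap at `y` is the largest element of a clopen half, so a basic set around
it inside that half determines `y`. -/
theorem mk_le_weight (hY0 : Disjoint Y (eventuallyEq false)) : #Y ≤ weight (DoubleArrow Y) := by
  refine le_weight fun B hB => ?_
  have key : ∀ y : Y, ∃ U ∈ B, (∃ p ∈ U, p.proj = y.1) ∧
      ∀ p ∈ U, side y.1 p = false := by
    intro y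
    obtain ⟨U, hU, hyU, hUy⟩ := hB.exists_subset_of_mem_open
      (a := mk y.1 false (Or.inl ⟨rfl, disjoint_left.1 hY0 y.2⟩))
      (u := {p | side y.1 p = false}) (side_proj (mk y.1 false _))
      (isClopen_setOf_eq (continuous_side hY0 y.2) false).isOpen
    exact ⟨U, hU, ⟨_, hyU, rfl⟩, fun p hp => hUy hp⟩
  choose U hUB hU hUs using key
  refine mk_le_of_injective (f := fun y => (⟨U y, hUB y⟩ : B)) ?_
  have hle : ∀ y z : Y, U y = U z → toLex y.1 ≤ toLex z.1 := by
    intro y z h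
    obtain ⟨p, hp, hpy⟩ := hU y
    have := hUs z p (h ▸ hp)
    rw [← Bool.not_eq_true, side_eq_true, not_or, hpy] at this
    exact not_lt.1 this.1
  intro y z h
  have h : U y = U z := congrArg Subtype.val h
  exact Subtype.ext (toLex.injective (le_antisymm (hle y z h) (hle z y h.symm)))

theorem weight_eq (hY0 : Disjoint Y (eventuallyEq false)) (hY : ℵ₀ ≤ #Y) :
    weight (DoubleArrow Y) = #Y := by
  have := (compactSpace_and_continuous_coord hY0).1
  refine le_antisymm ((weight_le_of_separating (continuous_coord hY0) coord_separating).trans ?_)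
    (mk_le_weight hY0)
  rw [mk_sum, lift_id, lift_id, mk_nat, add_eq_right hY hY]

theorem isZeroDimensional (hY0 : Disjoint Y (eventuallyEq false)) :
    IsZeroDimensional (DoubleArrow Y) := by
  have := (compactSpace_and_continuous_coord hY0).1
  have : TotallyDisconnectedSpace (DoubleArrow Y) :=
    (isClosedEmbedding_of_separating (continuous_coord hY0)
      coord_separating).isEmbedding.isTotallyDisconnected_range.1
        (isTotallyDisconnected_of_totallyDisconnectedSpace _)
  exact isTopologicalBasis_isClopen

end DoubleArrow

/-! ### Small subsets of the Cantor set -/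

theorem isEventuallyBounded_of_mk_lt {F : Set (ℕ → ℕ)} (h : #F < boundingNumber) :
    IsEventuallyBounded F := by
  by_contra hF
  exact h.not_ge (csInf_le' ⟨F, hF, rfl⟩)

theorem boundingNumber_le_continuum : boundingNumber ≤ 𝔠 := by
  have hU : ¬ IsEventuallyBounded univ := by
    rintro ⟨g, hg⟩
    obtain ⟨n, hn⟩ := (hg (fun n => g n + 1) trivial).exists
    omega
  exact (csInf_le' ⟨univ, hU, rfl⟩ : boundingNumber ≤ #(univ : Set (ℕ → ℕ))).trans (by simp)

/-- Sets of size less than the bounding number are `λ'`-sets. -/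
theorem isLambdaPrimeSet_of_mk_lt {Y : Set (ℕ → Bool)} (h : #Y < boundingNumber) :
    IsLambdaPrimeSet Y := by
  intro C hC
  suffices hG : ∃ G : Set (ℕ → Bool), IsGδ G ∧ C ⊆ G ∧ Y ∩ G ⊆ C by
    obtain ⟨G, hG, hCG, hYG⟩ := hG
    have heq : ((↑) ⁻¹' C : Set (Y ∪ C : Set (ℕ → Bool))) = (↑) ⁻¹' G := by
      ext ⟨x, hx⟩
      exact ⟨fun h => hCG h, fun h => hx.elim (fun hy => hYG ⟨hy, h⟩) id⟩
    rw [heq]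
    exact hG.preimage continuous_subtype_val
  rcases C.eq_empty_or_nonempty with rfl | hne
  · exact ⟨∅, isOpen_empty.isGδ, Subset.rfl, inter_subset_right⟩
  obtain ⟨c, rfl⟩ := hC.exists_eq_range hne
  obtain ⟨g, hg⟩ := isEventuallyBounded_of_mk_lt
    (F := (fun y n => PiNat.firstDiff (c n) y) '' Y) (mk_image_le.trans_lt h)
  -- Since `g` eventually bounds the agreement of `y` with `c n`, each `y ∈ Y` off the countable set
  -- lies in some `F m`, while `F m` contains `c n` only for `n < m`.
  let F : ℕ → Set (ℕ → Bool) := fun m => ⋂ n ≥ m, (PiNat.cylinder (c n) (g n + 1))ᶜ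
  have hF : ∀ m, IsClosed (F m) := fun m => isClosed_biInter fun n _ =>
    (PiNat.isOpen_cylinder _ _ _).isClosed_compl
  refine ⟨⋂ m, ((F m)ᶜ ∪ c '' Iio m), .iInter fun m => ?_, ?_, ?_⟩
  · exact (hF m).isOpen_compl.isGδ.union ((finite_Iio m).image c).isGδ
  · rintro _ ⟨n, rfl⟩
    refine mem_iInter.2 fun m => ?_
    by_cases hnm : n < m
    · exact Or.inr ⟨n, hnm, rfl⟩
    · exact Or.inl fun hF => mem_iInter₂.1 hF n (not_lt.1 hnm) (PiNat.self_mem_cylinder _ _)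
  · rintro y ⟨hy, hyG⟩
    by_contra hyc
    obtain ⟨m, hm⟩ := eventually_atTop.1 (hg _ (mem_image_of_mem _ hy))
    rcases mem_iInter.1 hyG m with h | ⟨n, -, rfl⟩
    · refine h (mem_iInter₂.2 fun n hn hcyl => ?_)
      have hne : c n ≠ y := fun h => hyc ⟨n, h⟩
      rw [PiNat.mem_cylinder_comm, PiNat.mem_cylinder_iff_le_firstDiff hne] at hcyl
      have := hm n hn
      omega
    · exact hyc (mem_range_self n)

/-- Tail classes are countable, so saturating κ points keeps the size; `Q` is saturated, so its
complement is not left. -/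
theorem exists_saturated_set {κ : Cardinal.{0}} (h0 : ℵ₀ ≤ κ) (hκ : κ ≤ 𝔠) :
    ∃ Y : Set (ℕ → Bool), Disjoint Y (eventuallyEq false ∪ eventuallyEq true) ∧
      IsSaturated Y ∧ #Y = κ := by
  have hmk : #(ℕ → Bool) = 𝔠 := by simp
  have : Infinite (ℕ → Bool) := infinite_iff.2 (hmk ▸ aleph0_le_continuum)
  set Q : Set (ℕ → Bool) := eventuallyEq false ∪ eventuallyEq true
  have hQ : #Q < #(ℕ → Bool) := by
    rw [hmk]
    exact (((countable_eventuallyEq false).union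
      (countable_eventuallyEq true)).le_aleph0).trans_lt aleph0_lt_continuum
  have hQc : #(Qᶜ : Set (ℕ → Bool)) = 𝔠 := by rw [mk_compl_of_infinite Q hQ, hmk]
  obtain ⟨Z, hZQ, hZ⟩ := le_mk_iff_exists_subset.1 (hκ.trans_eq hQc.symm)
  refine ⟨saturation Z, ?_, isSaturated_saturation Z, le_antisymm ?_ ?_⟩
  · refine disjoint_left.2 ?_
    rintro x ⟨z, hz, hxz⟩ (hx | hx)
    · exact hZQ hz (Or.inl ((isSaturated_eventuallyEq false).mem_of_tailEquiv hxz.symm hx))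
    · exact hZQ hz (Or.inr ((isSaturated_eventuallyEq true).mem_of_tailEquiv hxz.symm hx))
  · have hsub : saturation Z ⊆ ⋃ z ∈ Z, {y | TailEquiv y z} := by
      rintro x ⟨z, hz, hxz⟩
      exact mem_biUnion hz hxz
    have hsup : ⨆ z : Z, #{y | TailEquiv y z.1} ≤ ℵ₀ :=
      ciSup_le' fun z => (countable_tailEquiv z.1).le_aleph0
    calc #(saturation Z) ≤ #(⋃ z ∈ Z, {y | TailEquiv y z}) := mk_le_mk_of_subset hsub
      _ ≤ #Z * ⨆ z : Z, #{y | TailEquiv y z.1} := mk_biUnion_le _ _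
      _ ≤ #Z * ℵ₀ := mul_le_mul' le_rfl hsup
      _ = κ := by rw [hZ, mul_aleph0_eq h0]
  · rw [← hZ]
    exact mk_le_mk_of_subset (subset_saturation Z)

end CDHSpaces

open CDHSpaces in
theorem mainTheorem11 (κ : Cardinal.{0}) (hκ : κ < CDHSpaces.boundingNumber) :
    (∃ (X : Type) (_ : LinearOrder X) (_ : TopologicalSpace X),
      OrderTopology X ∧ CompactSpace X ∧ CDHSpaces.IsZeroDimensional X ∧
        CDHSpaces.IsCDH X ∧ CDHSpaces.weight X = κ) ∧
    (Cardinal.aleph0 ≤ κ →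
      ∃ Y : Set (ℕ → Bool),
        Disjoint Y (CDHSpaces.eventuallyEq false ∪ CDHSpaces.eventuallyEq true) ∧
        CDHSpaces.IsSaturated Y ∧ CDHSpaces.IsLambdaPrimeSet Y ∧ Cardinal.mk Y = κ ∧
        CompactSpace (CDHSpaces.DoubleArrow Y) ∧
        CDHSpaces.IsZeroDimensional (CDHSpaces.DoubleArrow Y) ∧
        CDHSpaces.IsCDH (CDHSpaces.DoubleArrow Y) ∧
        CDHSpaces.weight (CDHSpaces.DoubleArrow Y) = κ) := by
  have main : Cardinal.aleph0 ≤ κ → ∃ Y : Set (ℕ → Bool),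
      Disjoint Y (eventuallyEq false ∪ eventuallyEq true) ∧
      IsSaturated Y ∧ IsLambdaPrimeSet Y ∧ Cardinal.mk Y = κ ∧ CompactSpace (DoubleArrow Y) ∧
      IsZeroDimensional (DoubleArrow Y) ∧ IsCDH (DoubleArrow Y) ∧ weight (DoubleArrow Y) = κ := by
    intro h0
    obtain ⟨Y, hY, hs, rfl⟩ := exists_saturated_set h0 (hκ.le.trans boundingNumber_le_continuum)
    obtain ⟨hY0, hY1⟩ := disjoint_union_right.1 hY
    have hl := isLambdaPrimeSet_of_mk_lt hκ
    exact ⟨Y, hY, hs, hl, rfl, (DoubleArrow.compactSpace_and_continuous_coord hY0).1,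
      DoubleArrow.isZeroDimensional hY0, DoubleArrow.isCDH hY0 hs hY1 hl,
      DoubleArrow.weight_eq hY0 h0⟩
  refine ⟨?_, main⟩
  rcases lt_or_ge κ ℵ₀ with hfin | hinf
  -- A finite discrete order works: its only dense subset is the whole space.
  · obtain ⟨n, rfl⟩ := lt_aleph0.1 hfin
    refine ⟨Fin n, inferInstance, inferInstance, inferInstance, inferInstance, ?_, ?_, ?_⟩
    · exact isTopologicalBasis_isClopen
    · refine ⟨inferInstance, fun D E _ hD _ hE => ⟨Homeomorph.refl _, ?_⟩⟩
      rw [dense_discrete.1 hD, dense_discrete.1 hE]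
      simp
    · rw [weight_eq_mk_of_discrete, mk_fin]
  · obtain ⟨Y, -, -, -, -, hc, hz, hcdh, hw⟩ := main hinf
    exact ⟨DoubleArrow Y, inferInstance, inferInstance, inferInstance, hc, hz, hcdh, hw⟩
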